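/- Let $d\ge 1$. For $z=(x,\omega)\in\mathbb{R}^{2d}$ and $f\in L^2(\mathbb{R}^d)$ write $\pi(z)f(t)=e^{2\pi i\omega\cdot t}f(t-x)$ and, for $g\in L^2(\mathbb{R}^d)$, $V_gf(z)=\langle f,\pi(z)g\rangle$, where $\langle\cdot,\cdot\rangle$ is the $L^2$ inner product, linear in the first argument. Let $\Lambda\subset\mathbb{R}^{2d}$ be a (full-rank) lattice and let $g\in L^2(\mathbb{R}^d)$ be such that $(g,\Lambda)$ induces a tight Gabor frame with frame constant $A>0$, i.e. $$\sum_{\lambda\in\Lambda}|\langle f,\pi(\lambda)g\rangle|^2=A\,\|f\|_{L^2}^2\qquad\text{for all } f\in L^2(\mathbb{R}^d),$$ and such that $g\in M^*_\Lambda(\mathbb{R}^d)$, i.e. $\sum_{\lambda\in\Lambda}|\lambda|\,|V_gg(\lambda)|^2<\infty$. Put $K_g(\lambda,\lambda')=\langle\pi(\lambda')g,\pi(\lambda)g\rangle$ for $\lambda,\lambda'\in\Lambda$. Then there is a determinantal point process $\mathcal{X}_g$ on $\Lambda$, unique in law, with correlation kernel $A^{-1}K_g$ (which is $K_g$ itself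 when the frame constant is $A=1$), that is, a random subset $\mathcal{X}_g\subset\Lambda$ with $$\mathbb{P}\big[\lambda_1,\dots,\lambda_k\in\mathcal{X}_g\big]=\det\big[A^{-1}K_g(\lambda_i,\lambda_j)\big]_{1\le i,j\le k}\qquad\text{for all } k\ge 0 \text{ and distinct } \lambda_1,\dots,\lambda_k\in\Lambda.$$ The process $\mathcal{X}_g$ is class I hyperuniform: the number $\mathcal{X}_g(B(0,R))$ of its points in the closed Euclidean ball $B(0,R)\subset\mathbb{R}^{2d}$ has finite variance, and as $R\to\infty$ $$\mathbb{V}\big[\mathcal{X}_g(B(0,R))\big]=O(R^{2d-1}),$$ so that in particular $\mathcal{X}_g$ is hyperuniform: $\mathbb{V}\big[\mathcal{X}_g(B(0,R))\big]=o(R^{2d})$. -/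

import Mathlib

open MeasureTheory Filter

noncomputable section

/-- Time-frequency space `ℝ^{2d}`, with points `z = (x, ω)` and the Euclidean norm. -/
abbrev PhaseSpace (d : ℕ) : Type :=
  WithLp 2 (EuclideanSpace ℝ (Fin d) × EuclideanSpace ℝ (Fin d))

/-- The Hilbert space `L²(ℝ^d)` of complex-valued functions with respect to Lebesgue measure. -/
abbrev L2 (d : ℕ) : Type :=
  Lp ℂ 2 (volume : Measure (EuclideanSpace ℝ (Fin d)))

/-- The function `t ↦ e^{2πi ω·t} f(t - x)` for `z = (x, ω)`. -/
def tfShiftFun {d : ℕ} (z : PhaseSpace d) (f : EuclideanSpace ℝ (Fin d) → ℂ) :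
    EuclideanSpace ℝ (Fin d) → ℂ :=
  fun t => Complex.exp (2 * Real.pi * Complex.I * (inner ℝ z.snd t : ℝ)) * f (t - z.fst)

theorem memLp_tfShiftFun {d : ℕ} (z : PhaseSpace d) {f : EuclideanSpace ℝ (Fin d) → ℂ}
    (hf : MemLp f 2 volume) : MemLp (tfShiftFun z f) 2 volume := by
  have h1 : MemLp (fun t => f (t - z.fst)) 2 volume :=
    hf.comp_measurePreserving (measurePreserving_sub_right volume z.fst)
  refine h1.of_le ?_ (Eventually.of_forall fun t => ?_)
  · refine AEStronglyMeasurable.mul (Continuous.aestronglyMeasurable ?_) h1.1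
    fun_prop
  · have h2 : (2 * Real.pi * Complex.I * (inner ℝ z.snd t : ℝ) : ℂ)
        = ((2 * Real.pi * inner ℝ z.snd t : ℝ) : ℂ) * Complex.I := by
      push_cast; ring
    simp only [tfShiftFun, norm_mul, h2, Complex.norm_exp_ofReal_mul_I, one_mul, le_refl]

/-- The time-frequency shift `π(z)` on `L²(ℝ^d)`: `π(x, ω) f (t) = e^{2πi ω·t} f(t - x)`. -/
def tfShift {d : ℕ} (z : PhaseSpace d) (f : L2 d) : L2 d :=
  (memLp_tfShiftFun z (Lp.memLp f)).toLp (tfShiftFun z f)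

/-- The short-time Fourier transform `V_g f(z) = ⟨f, π(z) g⟩`. The pairing of the mathematical
text is linear in its first entry, Mathlib's `inner` in its second one. -/
def stft {d : ℕ} (g f : L2 d) (z : PhaseSpace d) : ℂ :=
  inner ℂ (tfShift z g) f

/-- `(g, Λ)` induces a Gabor frame with frame bounds `A, B > 0`:
`A ‖f‖² ≤ ∑_{λ ∈ Λ} |⟨f, π(λ) g⟩|² ≤ B ‖f‖²` for all `f ∈ L²(ℝ^d)`.
The frame is tight when `A = B`. -/
def IsGaborFrame {d : ℕ} (g : L2 d) (Λ : Submodule ℤ (PhaseSpace d)) (A B : ℝ) : Prop :=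
  0 < A ∧ 0 < B ∧ ∀ f : L2 d,
    Summable (fun l : Λ => ‖stft g f l‖ ^ 2) ∧
    A * ‖f‖ ^ 2 ≤ ∑' l : Λ, ‖stft g f l‖ ^ 2 ∧
    ∑' l : Λ, ‖stft g f l‖ ^ 2 ≤ B * ‖f‖ ^ 2

/-- `g ∈ M*_Λ(ℝ^d)`: `∑_{λ ∈ Λ} |λ| |V_g g(λ)|² < ∞`. -/
def MemMStar {d : ℕ} (g : L2 d) (Λ : Submodule ℤ (PhaseSpace d)) : Prop :=
  Summable (fun l : Λ => ‖(l : PhaseSpace d)‖ * ‖stft g g l‖ ^ 2)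

/-- The kernel `K_g(λ, λ') = ⟨π(λ') g, π(λ) g⟩` on `Λ × Λ`. -/
def gaborKernel {d : ℕ} (g : L2 d) (Λ : Submodule ℤ (PhaseSpace d)) (l l' : Λ) : ℂ :=
  inner ℂ (tfShift (l : PhaseSpace d) g) (tfShift (l' : PhaseSpace d) g)

/-- A random subset `X` of a discrete set `ι`, on the probability space `(S, P)`, is a
determinantal point process with correlation kernel `K`: for any `k` distinct points its `k`-point
intensity `P(x₁, …, x_k ∈ X)` equals `det [K(x_i, x_j)]`. Here `Set ι` carries the σ-algebra
generated by the events that a given point belongs to the set. -/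
def IsDeterminantal {S ι : Type*} [MeasurableSpace S] (P : Measure S) (X : S → Set ι)
    (K : ι → ι → ℂ) : Prop :=
  Measurable X ∧ ∀ (k : ℕ) (x : Fin k → ι), Function.Injective x →
    ((P.real {s | ∀ i, x i ∈ X s} : ℝ) : ℂ) = (Matrix.of fun i j => K (x i) (x j)).det

/-- The number of points of a random subset `X` of `Λ` in the ball `B(0, R)`
(a finite number, as `Λ` is discrete). -/
def ballCount {d : ℕ} {Λ : Submodule ℤ (PhaseSpace d)} {S : Type*} (X : S → Set Λ) (R : ℝ)
    (s : S) : ℝ :=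
  (X s ∩ {l : Λ | (l : PhaseSpace d) ∈ Metric.closedBall (0 : PhaseSpace d) R}).ncard

/-- Hyperuniformity: the number of points in `B(0, R)` has finite variance, of size
`o(R^{2d})` as `R → ∞`. -/
def IsHyperuniform {d : ℕ} {Λ : Submodule ℤ (PhaseSpace d)} {S : Type*} [MeasurableSpace S]
    (P : Measure S) (X : S → Set Λ) : Prop :=
  (∀ R : ℝ, MemLp (ballCount X R) 2 P) ∧
    (fun R : ℝ => ProbabilityTheory.variance (ballCount X R) P) =o[atTop]
      fun R : ℝ => R ^ (2 * d)

/-- Class I hyperuniformity: the number of points in `B(0, R)` has finite variance, of size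
`O(R^{2d-1})` as `R → ∞`. -/
def IsClassIHyperuniform {d : ℕ} {Λ : Submodule ℤ (PhaseSpace d)} {S : Type*} [MeasurableSpace S]
    (P : Measure S) (X : S → Set Λ) : Prop :=
  (∀ R : ℝ, MemLp (ballCount X R) 2 P) ∧
    (fun R : ℝ => ProbabilityTheory.variance (ballCount X R) P) =O[atTop]
      fun R : ℝ => R ^ (2 * d - 1)

end

/-! Write `K` for `A⁻¹ K_g`. It is a rescaled Gram kernel, so `0 ≤ K`, and the frame bound gives `K
≤ 1`. The tight frame identity at `f = π(i)g` gives `K i i = ∑ j, ‖K i j‖ ^ 2`: `K` is a projection.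

A kernel with `0 ≤ K ≤ 1` has a process: on finite windows the candidate probabilities are
determinants, nonnegative by `Matrix.det_exactMatrix_nonneg`, and compactness of `{0,1}^Λ` gives a
limit law. Inclusion events form a π-system, whence uniqueness.

The number variance in a finite set `F` is the sum of `‖K i j‖ ^ 2` over `i ∈ F`, `j ∉ F`. By
covariance (`norm_inner_tfShift`) each term depends only on `m = j - i`, so the variance is a sum
over `m` of `‖V_g g(m)‖ ^ 2 / A ^ 2` times the number of `i ∈ F` with `i + m ∉ F`
(`hasSum_card_boundary_mul`). For a ball this number is `O(‖m‖ R ^ (2d-1))` by volume packing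
(`exists_card_boundary_le`), and the `M*` condition makes the sum over `m` converge. -/

open scoped ComplexOrder Topology

/-! ### Determinantal probabilities on a finite set -/

namespace Matrix

/-- The matrix whose rows with index in `S` are those of `M`, the others those of `1 - M`. Its
determinant is the probability that a determinantal process with kernel `M` equals `S`. -/
def exactMatrix {n : Type*} [DecidableEq n] (M : Matrix n n ℂ) (S : Finset n) : Matrix n n ℂ :=
  of fun i j => if i ∈ S then M i j else (1 - M) i j

variable {n : Type*} [Fintype n] [DecidableEq n]

theorem det_piecewise_one (M : Matrix n n ℂ) (T : Finset n) :
    (of fun i j => if i ∈ T then M i j else if i = j then 1 else 0).det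
      = (M.toSquareBlockProp (· ∈ T)).det := by
  rw [twoBlockTriangular_det _ (· ∈ T)]
  · have h : toSquareBlockProp (of fun i j => if i ∈ T then M i j else if i = j then (1 : ℂ) else 0)
        (fun i => i ∉ T) = 1 := by
      ext ⟨i, hi⟩ ⟨j, hj⟩
      simp [toSquareBlockProp_def, hi, one_apply]
    have h' : toSquareBlockProp (of fun i j => if i ∈ T then M i j else if i = j then (1 : ℂ) else 0)
        (· ∈ T) = M.toSquareBlockProp (· ∈ T) := by
      ext ⟨i, hi⟩ ⟨j, hj⟩
      simp [toSquareBlockProp_def]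
    rw [h, h', det_one, mul_one]
    congr!
  · intro i hi j hj
    have : i ≠ j := fun h => hi (h ▸ hj)
    simp [hi, this]

/-- Multilinearity in the rows: split each row outside `T` of the identity as `M + (1 - M)`, and
each row in `T` as `M + 0`. Choices `S` not containing `T` have a zero row. -/
theorem sum_det_exactMatrix (M : Matrix n n ℂ) (T : Finset n) :
    ∑ S with T ⊆ S, (exactMatrix M S).det = (M.toSquareBlockProp (· ∈ T)).det := by
  rw [← det_piecewise_one]
  have key := (detRowAlternating (n := n) (R := ℂ)).map_add_univ
    (fun i j => M i j) (fun i j => if i ∈ T then 0 else (1 - M) i j)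
  have h1 : ((fun i j => M i j) + fun i j => if i ∈ T then 0 else (1 - M) i j)
      = of fun i j => if i ∈ T then M i j else if i = j then (1 : ℂ) else 0 := by
    ext i j
    by_cases hi : i ∈ T <;> simp [hi, one_apply]
  rw [h1] at key
  refine Eq.trans ?_ key.symm
  rw [Finset.sum_filter]
  refine Finset.sum_congr rfl fun S _ => ?_
  split_ifs with hTS
  · change det _ = det _
    congr 1
    ext i j
    by_cases hi : i ∈ S
    · simp [exactMatrix, hi]
    · have hiT : i ∉ T := fun h => hi (hTS h)
      simp [exactMatrix, hi, hiT]
  · obtain ⟨i, hiT, hiS⟩ := Finset.not_subset.1 hTS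
    symm
    change det _ = 0
    refine det_eq_zero_of_row_eq_zero i fun j => ?_
    simp [hiT, hiS]

/-- The L-ensemble formula: with `L = M (1 - M)⁻¹`, the determinant is `det L_S * det (1 - M)`. -/
theorem det_exactMatrix_nonneg_of_posDef {M : Matrix n n ℂ} (hM : M.PosSemidef)
    (hM' : (1 - M).PosDef) (S : Finset n) : 0 ≤ (exactMatrix M S).det := by
  set Q := (1 - M)⁻¹ with hQ
  have hu : IsUnit (1 - M).det := hM'.isUnit.map detMonoidHom
  have hQ1 : (1 - M) * Q = 1 := mul_nonsing_inv _ hu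
  have hQ1' : Q * (1 - M) = 1 := nonsing_inv_mul _ hu
  have hQH : Qᴴ = Q := hM'.isHermitian.inv.eq
  have hMH : Mᴴ = M := hM.isHermitian.eq
  have hNH : (1 - M)ᴴ = 1 - M := hM'.isHermitian.eq
  have hL : (M * Q).PosSemidef := by
    -- The bracket equals `(1 - M) M`, written as a sum of congruences to make its positivity
    -- visible.
    have e : M * Q = Qᴴ * ((1 - M)ᴴ * M * (1 - M) + Mᴴ * (1 - M) * M) * Q := by
      have : (1 - M)ᴴ * M * (1 - M) + Mᴴ * (1 - M) * M = (1 - M) * M := by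
        rw [hNH, hMH]; noncomm_ring
      rw [this, hQH, ← Matrix.mul_assoc Q, hQ1', Matrix.one_mul]
    rw [e]
    exact ((hM.conjTranspose_mul_mul_same _).add
      (hM'.posSemidef.conjTranspose_mul_mul_same _)).conjTranspose_mul_mul_same _
  have e : exactMatrix M S
      = (of fun i j => if i ∈ S then (M * Q) i j else if i = j then 1 else 0) * (1 - M) := by
    have h1 : M = M * Q * (1 - M) := by rw [Matrix.mul_assoc, hQ1', Matrix.mul_one]
    ext i j
    by_cases hi : i ∈ S
    · simp only [exactMatrix, of_apply, hi, if_true, mul_apply (M := of _)]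
      rw [← mul_apply, ← h1]
    · simp [exactMatrix, of_apply, hi, mul_apply (M := of _)]
  rw [e, det_mul, det_piecewise_one]
  exact mul_nonneg (hL.submatrix _).det_nonneg hM'.det_pos.le

/-- When `1 - M` is singular, pass to the limit `t → 1⁻` along `t M`, where `1 - t M = (1 - t) + t
(1 - M)` is positive definite. -/
theorem det_exactMatrix_nonneg {M : Matrix n n ℂ} (hM : M.PosSemidef)
    (hM' : (1 - M).PosSemidef) (S : Finset n) : 0 ≤ (exactMatrix M S).det := by
  have hc : Continuous fun t : ℝ => (exactMatrix ((t : ℂ) • M) S).det := by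
    refine Continuous.matrix_det ?_
    refine continuous_matrix fun i j => ?_
    by_cases hi : i ∈ S <;> simp only [exactMatrix, hi, of_apply, if_true, if_false, sub_apply,
      smul_apply, smul_eq_mul] <;> fun_prop
  have ht : Tendsto (fun t : ℝ => (exactMatrix ((t : ℂ) • M) S).det) (𝓝[<] 1)
      (𝓝 (exactMatrix M S).det) := by
    have := (hc.tendsto 1).mono_left (nhdsWithin_le_nhds (s := Set.Iio 1))
    simpa using this
  refine ge_of_tendsto ht ?_
  filter_upwards [Ioo_mem_nhdsLT (show (0 : ℝ) < 1 by norm_num)] with t ht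
  refine det_exactMatrix_nonneg_of_posDef (hM.smul (by exact_mod_cast ht.1.le)) ?_ S
  have e : 1 - (t : ℂ) • M = ((1 - t : ℝ) : ℂ) • (1 : Matrix n n ℂ) + (t : ℂ) • (1 - M) := by
    ext i j; simp; ring
  rw [e]
  refine PosDef.add_posSemidef ?_ (hM'.smul (by exact_mod_cast ht.1.le))
  exact PosDef.one.smul (by exact_mod_cast sub_pos.2 ht.2)

theorem sum_det_exactMatrix_submatrix {m : Type*} [Fintype m] [DecidableEq m] (M : Matrix n n ℂ)
    {f : m → n} (hf : Function.Injective f) :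
    ∑ S with ∀ i, f i ∈ S, (exactMatrix M S).det = (M.submatrix f f).det := by
  have h1 := sum_det_exactMatrix M (Finset.univ.image f)
  have h2 : ∀ S : Finset n, Finset.univ.image f ⊆ S ↔ ∀ i, f i ∈ S := fun S => by
    simp [Finset.image_subset_iff]
  simp only [h2] at h1
  rw [h1]
  let e : m ≃ {a // a ∈ Finset.univ.image f} :=
    Equiv.ofBijective (fun i => ⟨f i, Finset.mem_image_of_mem f (Finset.mem_univ i)⟩)
      ⟨fun i j h => hf (congrArg Subtype.val h), fun ⟨a, ha⟩ => by
        obtain ⟨i, -, hi⟩ := Finset.mem_image.1 ha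
        exact ⟨i, Subtype.ext hi⟩⟩
  rw [← det_submatrix_equiv_self e]
  rfl

end Matrix

/-! ### Existence by compactness -/

section Existence

/-- The law, in `{0, 1}^ι`, of the determinantal process on the finite set `F` whose kernel is the
restriction of `K`. -/
noncomputable def finiteDPPMeasure {ι : Type*} [DecidableEq ι] (K : ι → ι → ℂ) (F : Finset ι) : Measure (ι → Bool) :=
  ∑ S : Finset F, ENNReal.ofReal
    ((Matrix.of fun i j : F => K i j).exactMatrix S).det.re •
      Measure.dirac fun l => decide (l ∈ S.map (Function.Embedding.subtype _))

theorem measurableSet_cylinder {ι κ : Type*} [Countable κ] (x : κ → ι) :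
    MeasurableSet {y : ι → Bool | ∀ i, y (x i) = true} := by
  simp only [Set.ofPred_forall]
  exact MeasurableSet.iInter fun i => measurableSet_eq_fun (measurable_pi_apply (x i)) measurable_const

theorem isClopen_cylinder {ι κ : Type*} [Finite κ] (x : κ → ι) :
    IsClopen {y : ι → Bool | ∀ i, y (x i) = true} := by
  simp only [Set.ofPred_forall]
  exact isClopen_iInter_of_finite fun i =>
    (isClopen_discrete {true}).preimage (continuous_apply (x i))

theorem finiteDPPMeasure_cylinder {ι : Type*} [DecidableEq ι] {K : ι → ι → ℂ} {F : Finset ι}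
    (h0 : (Matrix.of fun i j : F => K i j).PosSemidef)
    (h1 : (1 - Matrix.of fun i j : F => K i j).PosSemidef)
    {k : ℕ} {x : Fin k → ι} (hx : Function.Injective x) (hxF : ∀ i, x i ∈ F) :
    finiteDPPMeasure K F {y | ∀ i, y (x i) = true}
      = ENNReal.ofReal (Matrix.of fun i j => K (x i) (x j)).det.re := by
  classical
  have hx' : Function.Injective fun i => (⟨x i, hxF i⟩ : F) := fun i j h =>
    hx (congrArg Subtype.val h)
  have key := Matrix.sum_det_exactMatrix_submatrix (Matrix.of fun i j : F => K i j) hx'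
  have e : (Matrix.of fun i j : F => K i j).submatrix (fun i => (⟨x i, hxF i⟩ : F))
      (fun i => (⟨x i, hxF i⟩ : F)) = Matrix.of fun i j => K (x i) (x j) := rfl
  rw [← e, ← key, Complex.re_sum, ENNReal.ofReal_sum_of_nonneg
    fun S _ => (Complex.nonneg_iff.1 (Matrix.det_exactMatrix_nonneg h0 h1 S)).1, finiteDPPMeasure,
    Measure.coe_finsetSum, Finset.sum_apply, Finset.sum_filter]
  refine Finset.sum_congr (by congr!) fun S _ => ?_
  rw [Measure.smul_apply, Measure.dirac_apply' _ (measurableSet_cylinder x)]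
  by_cases h : ∀ i, (⟨x i, hxF i⟩ : F) ∈ S
  · rw [if_pos h, Set.indicator_of_mem]
    · simp
    · simpa [hxF] using h
  · rw [if_neg h, Set.indicator_of_notMem]
    · simp
    · simpa [hxF] using h

theorem isProbabilityMeasure_finiteDPPMeasure {ι : Type*} [DecidableEq ι] {K : ι → ι → ℂ} {F : Finset ι}
    (h0 : (Matrix.of fun i j : F => K i j).PosSemidef)
    (h1 : (1 - Matrix.of fun i j : F => K i j).PosSemidef) :
    IsProbabilityMeasure (finiteDPPMeasure K F) := by
  refine ⟨?_⟩
  -- The cylinder over no points is the whole space, and the empty determinant is `1`.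
  have := finiteDPPMeasure_cylinder h0 h1 (x := (Fin.elim0 : Fin 0 → ι))
    (fun i => i.elim0) (fun i => i.elim0)
  simpa using this

/-- A Hermitian kernel `0 ≤ K ≤ 1` on a countable set is the correlation kernel of a determinantal
point process. -/
theorem exists_isDeterminantal {ι : Type*} [DecidableEq ι] [Countable ι] {K : ι → ι → ℂ}
    (h0 : ∀ F : Finset ι, (Matrix.of fun i j : F => K i j).PosSemidef)
    (h1 : ∀ F : Finset ι, (1 - Matrix.of fun i j : F => K i j).PosSemidef) :
    ∃ P : ProbabilityMeasure (Set ι), IsDeterminantal (P : Measure (Set ι)) id K := by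
  classical
  let μ : Finset ι → ProbabilityMeasure (ι → Bool) := fun F =>
    ⟨finiteDPPMeasure K F, isProbabilityMeasure_finiteDPPMeasure (h0 F) (h1 F)⟩
  -- A limit along an ultrafilter finer than `atTop` needs no compatibility between the finite laws.
  let U : Ultrafilter (Finset ι) := Ultrafilter.of atTop
  obtain ⟨ν, -, hν⟩ := isCompact_univ.ultrafilter_le_nhds (U.map μ) (by simp)
  have hν : Tendsto μ U (𝓝 ν) := hν
  have hm : Measurable fun y : ι → Bool => {l | y l = true} :=
    measurable_set_iff.2 fun l => (measurable_of_countable (f := fun b : Bool => b = true)).comp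
      (measurable_pi_apply l)
  refine ⟨ν.map hm.aemeasurable, measurable_id, fun k x hx => ?_⟩
  have hc : (ν : Measure (ι → Bool)) {y | ∀ i, y (x i) = true}
      = ENNReal.ofReal (Matrix.of fun i j => K (x i) (x j)).det.re := by
    -- Cylinders are clopen, so weak convergence passes to their masses, which are constant once `F`
    -- contains the points.
    refine tendsto_nhds_unique
      (ProbabilityMeasure.tendsto_measure_of_null_frontier_of_tendsto' hν
        (by simp [isClopen_cylinder x])) ?_
    refine tendsto_const_nhds.congr' ?_
    have hle : (U : Filter (Finset ι)) ≤ atTop := Ultrafilter.of_le _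
    filter_upwards [hle (eventually_ge_atTop (Finset.univ.image x))] with F hF
    exact (finiteDPPMeasure_cylinder (h0 F) (h1 F) hx fun i =>
      hF (Finset.mem_image_of_mem x (Finset.mem_univ i))).symm
  have hdet : 0 ≤ (Matrix.of fun i j => K (x i) (x j)).det := by
    have := (h0 (Finset.univ.image x)).submatrix
      (fun i => ⟨x i, Finset.mem_image_of_mem x (Finset.mem_univ i)⟩)
    exact this.det_nonneg
  have hms : MeasurableSet {s : Set ι | ∀ i, x i ∈ s} := by
    simp only [Set.ofPred_forall]
    exact MeasurableSet.iInter fun i => measurableSet_mem (x i)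
  have : (ν.map hm.aemeasurable : Measure (Set ι)) {s | ∀ i, x i ∈ id s}
      = ENNReal.ofReal (Matrix.of fun i j => K (x i) (x j)).det.re := by
    rw [← hc]
    exact Measure.map_apply hm hms
  rw [Measure.real, this, ENNReal.toReal_ofReal (Complex.nonneg_iff.1 hdet).1]
  exact Complex.ext rfl (Complex.nonneg_iff.1 hdet).2

end Existence

/-! ### Uniqueness of the law -/

section Uniqueness

theorem isPiSystem_setOf_subset (ι : Type*) :
    IsPiSystem (Set.range fun F : Finset ι => {s : Set ι | ↑F ⊆ s}) := by
  classical
  rintro _ ⟨F, rfl⟩ _ ⟨G, rfl⟩ -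
  exact ⟨F ∪ G, by ext s; simp⟩

theorem generateFrom_setOf_subset (ι : Type*) :
    MeasurableSpace.generateFrom (Set.range fun F : Finset ι => {s : Set ι | ↑F ⊆ s})
      = Set.instMeasurableSpace := by
  apply le_antisymm
  · refine MeasurableSpace.generateFrom_le ?_
    rintro _ ⟨F, rfl⟩
    have : {s : Set ι | ↑F ⊆ s} = ⋂ i : F, {s : Set ι | (i : ι) ∈ s} := by
      ext s; simp [Set.subset_def]
    change MeasurableSet {s : Set ι | ↑F ⊆ s}
    rw [this]
    exact MeasurableSet.iInter fun i => measurableSet_mem _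
  · have : @Measurable _ _ (MeasurableSpace.generateFrom
        (Set.range fun F : Finset ι => {s : Set ι | ↑F ⊆ s})) Set.instMeasurableSpace id := by
      refine (@measurable_set_iff _ _ (_) _).2 fun a => ?_
      refine (@measurableSet_setOfPred _ (_) _).1
        (MeasurableSpace.measurableSet_generateFrom ⟨{a}, ?_⟩)
      simp
    exact fun s hs => this hs

/-- The correlation kernel determines the law of a determinantal point process. -/
theorem IsDeterminantal.measure_unique {ι : Type*} {K : ι → ι → ℂ} {P Q : Measure (Set ι)}
    [IsProbabilityMeasure P] [IsProbabilityMeasure Q] (hP : IsDeterminantal P id K)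
    (hQ : IsDeterminantal Q id K) : P = Q := by
  refine ext_of_generate_finite _ (generateFrom_setOf_subset ι).symm (isPiSystem_setOf_subset ι)
    ?_ (by simp)
  rintro _ ⟨F, rfl⟩
  have e : {s : Set ι | ↑F ⊆ s} = {s | ∀ i, ((F.equivFin.symm i : F) : ι) ∈ id s} := by
    ext s
    rw [Set.mem_ofPred_eq, Set.mem_ofPred_eq, F.equivFin.symm.forall_congr_left]
    simp [Set.subset_def]
  have hi : Function.Injective fun i => ((F.equivFin.symm i : F) : ι) :=
    Subtype.val_injective.comp F.equivFin.symm.injective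
  have h := (hP.2 _ _ hi).trans (hQ.2 _ _ hi).symm
  rw [← e] at h
  exact (measureReal_eq_measureReal_iff).1 (Complex.ofReal_injective h)

end Uniqueness

/-! ### Number variance -/

section Variance

variable {S ι : Type*} [MeasurableSpace S] {P : Measure S} {X : S → Set ι} {K : ι → ι → ℂ}

theorem IsDeterminantal.measurableSet_mem (hX : IsDeterminantal P X K) (i : ι) :
    MeasurableSet {s | i ∈ X s} :=
  measurableSet_setOfPred.2 (measurable_set_iff.1 hX.1 i)

theorem IsDeterminantal.measureReal_mem (hX : IsDeterminantal P X K) (i : ι) :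
    P.real {s | i ∈ X s} = (K i i).re := by
  have h := hX.2 1 ![i] (Function.injective_of_subsingleton _)
  simp only [Matrix.det_fin_one, Matrix.of_apply, Matrix.cons_val_fin_one,
    forall_const] at h
  rw [← h, Complex.ofReal_re]

theorem IsDeterminantal.measureReal_mem_inter_mem (hX : IsDeterminantal P X K)
    (hK : ∀ i j, K j i = star (K i j)) {i j : ι} (hij : i ≠ j) :
    P.real ({s | i ∈ X s} ∩ {s | j ∈ X s}) = (K i i).re * (K j j).re - ‖K i j‖ ^ 2 := by
  have h := hX.2 2 ![i, j] (by
    intro a b hab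
    fin_cases a <;> fin_cases b <;> simp_all [eq_comm])
  have hre : ∀ i, K i i = ((K i i).re : ℂ) := fun i =>
    (Complex.conj_eq_iff_re.1 (hK i i).symm).symm
  have h3 : K i j * K j i = ((‖K i j‖ ^ 2 : ℝ) : ℂ) := by
    rw [hK i j]; simpa using Complex.mul_conj' (K i j)
  simp only [Matrix.det_fin_two, Matrix.of_apply, Fin.forall_fin_two, Matrix.cons_val_zero,
    Matrix.cons_val_one] at h
  rw [h3, hre i, hre j] at h
  exact_mod_cast h

theorem memLp_sum_indicator [IsFiniteMeasure P] {E : ι → Set S} (hE : ∀ i, MeasurableSet (E i))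
    (F : Finset ι) : MemLp (fun s => ∑ i ∈ F, (E i).indicator (fun _ => (1 : ℝ)) s) 2 P :=
  memLp_finsetSum _ fun i _ => memLp_indicator_const 2 (hE i) 1 (Or.inr (measure_ne_top _ _))

/-- Number variance of a determinantal point process in a finite set. -/
theorem IsDeterminantal.variance_sum_indicator [IsProbabilityMeasure P]
    (hX : IsDeterminantal P X K) (hK : ∀ i j, K j i = star (K i j)) (F : Finset ι) :
    ProbabilityTheory.variance
      (fun s => ∑ i ∈ F, {s | i ∈ X s}.indicator (fun _ => (1 : ℝ)) s) P
      = ∑ i ∈ F, ((K i i).re - ∑ j ∈ F, ‖K i j‖ ^ 2) := by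
  classical
  have hm : ∀ i, MemLp ({s | i ∈ X s}.indicator fun _ => (1 : ℝ)) 2 P := fun i =>
    memLp_indicator_const 2 (hX.measurableSet_mem i) 1 (Or.inr (measure_ne_top _ _))
  rw [ProbabilityTheory.variance_fun_sum' fun i _ => hm i]
  refine Finset.sum_congr rfl fun i hi => ?_
  have hcov : ∀ j, ProbabilityTheory.covariance ({s | i ∈ X s}.indicator fun _ => (1 : ℝ))
      ({s | j ∈ X s}.indicator fun _ => (1 : ℝ)) P
      = (if i = j then (K i i).re else 0) - ‖K i j‖ ^ 2 := by
    intro j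
    have hprod : ({s | i ∈ X s}.indicator fun _ => (1 : ℝ)) * ({s | j ∈ X s}.indicator fun _ => 1)
        = ({s | i ∈ X s} ∩ {s | j ∈ X s}).indicator fun _ => 1 := by
      ext s
      simp only [Pi.mul_apply, Set.indicator_apply, Set.mem_inter_iff]
      split_ifs <;> simp_all
    rw [ProbabilityTheory.covariance_eq_sub (hm i) (hm j), hprod,
      integral_indicator_const _ (hX.measurableSet_mem i),
      integral_indicator_const _ (hX.measurableSet_mem j),
      integral_indicator_const _ ((hX.measurableSet_mem i).inter (hX.measurableSet_mem j)),
      hX.measureReal_mem, hX.measureReal_mem]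
    -- On the diagonal the indicator is idempotent, giving `K i i - (K i i) ^ 2`; off it, the `2 ×
    -- 2` determinant leaves `-‖K i j‖ ^ 2`.
    split_ifs with hij
    · subst hij
      have hre : K i i = ((K i i).re : ℂ) := (Complex.conj_eq_iff_re.1 (hK i i).symm).symm
      have : ‖K i i‖ ^ 2 = (K i i).re ^ 2 := by
        rw [hre, Complex.norm_real, Complex.ofReal_re, Real.norm_eq_abs, sq_abs]
      rw [Set.inter_self, hX.measureReal_mem, this]
      simp; ring
    · rw [hX.measureReal_mem_inter_mem hK hij]
      simp
  simp only [hcov, Finset.sum_sub_distrib, Finset.sum_ite_eq, hi, if_true]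

end Variance

/-! ### Gram matrices of Bessel families -/

section FrameKernel

variable {E n : Type*} [NormedAddCommGroup E] [InnerProductSpace ℂ E] [Fintype n]

/-- A Bessel bound for the analysis operator is a bound for the synthesis operator. -/
theorem norm_sq_sum_smul_le_of_bessel {A : ℝ} (hA : 0 ≤ A) {v : n → E}
    (hv : ∀ f, ∑ i, ‖inner ℂ (v i) f‖ ^ 2 ≤ A * ‖f‖ ^ 2) (c : n → ℂ) :
    ‖∑ i, c i • v i‖ ^ 2 ≤ A * ∑ i, ‖c i‖ ^ 2 := by
  set h := ∑ i, c i • v i with hh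
  have hc0 : 0 ≤ ∑ i, ‖c i‖ ^ 2 := Finset.sum_nonneg fun i _ => sq_nonneg _
  rcases eq_or_ne h 0 with h0 | h0
  · simpa [h0] using mul_nonneg hA hc0
  -- Duality: expand one copy of `h`, apply Cauchy–Schwarz and the Bessel bound at `f = h`, then
  -- cancel `‖h‖ ^ 2`.
  have h1 : ‖h‖ ^ 2 ≤ ∑ i, ‖c i‖ * ‖inner ℂ (v i) h‖ := by
    have e : (inner ℂ h h : ℂ) = ∑ i, star (c i) * inner ℂ (v i) h := by
      conv_lhs => rw [hh, sum_inner, ← hh]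
      simp only [inner_smul_left]
      rfl
    calc ‖h‖ ^ 2 = ‖(inner ℂ h h : ℂ)‖ := by simp
      _ ≤ _ := by
        rw [e]
        refine (norm_sum_le _ _).trans (le_of_eq ?_)
        simp
  have h2 := Finset.sum_mul_sq_le_sq_mul_sq Finset.univ (fun i => ‖c i‖)
    fun i => ‖inner ℂ (v i) h‖
  have h3 : 0 < ‖h‖ ^ 2 := by positivity
  have h4 : (‖h‖ ^ 2) ^ 2 ≤ (∑ i, ‖c i‖ ^ 2) * (A * ‖h‖ ^ 2) :=
    ((pow_le_pow_left₀ h3.le h1 2).trans h2).trans (mul_le_mul_of_nonneg_left (hv h) hc0)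
  nlinarith

theorem posSemidef_one_sub_smul_gram [DecidableEq n] {A : ℝ} (hA : 0 < A) {v : n → E}
    (hv : ∀ f, ∑ i, ‖inner ℂ (v i) f‖ ^ 2 ≤ A * ‖f‖ ^ 2) :
    (1 - (A : ℂ)⁻¹ • Matrix.gram ℂ v).PosSemidef := by
  have hA' : (0 : ℂ) ≤ (A : ℂ)⁻¹ := by
    rw [← Complex.ofReal_inv]; exact_mod_cast (inv_pos.2 hA).le
  refine .of_dotProduct_mulVec_nonneg
    (Matrix.isHermitian_one.sub ((Matrix.posSemidef_gram ℂ v).smul hA').isHermitian) fun c => ?_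
  have h1 : star c ⬝ᵥ c = ((∑ i, ‖c i‖ ^ 2 : ℝ) : ℂ) := by
    simp [dotProduct, Complex.conj_mul']
  have h2 := norm_sq_sum_smul_le_of_bessel hA.le hv c
  rw [Matrix.sub_mulVec, Matrix.one_mulVec, dotProduct_sub, Matrix.smul_mulVec, dotProduct_smul,
    Matrix.star_dotProduct_gram_mulVec, h1, inner_self_eq_norm_sq_to_K, smul_eq_mul, sub_nonneg]
  have h3 : A⁻¹ * ‖∑ i, c i • v i‖ ^ 2 ≤ ∑ i, ‖c i‖ ^ 2 := by
    rw [inv_mul_le_iff₀ hA]; exact h2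
  refine le_trans (le_of_eq ?_) (Complex.real_le_real.2 h3)
  simp

end FrameKernel

/-! ### Covariance of time-frequency shifts -/

section Gabor

variable {d : ℕ}

theorem inner_tfShift (g : L2 d) (z w : PhaseSpace d) :
    inner ℂ (tfShift z g) (tfShift w g)
      = ∫ t, inner ℂ (tfShiftFun z g t) (tfShiftFun w g t) := by
  rw [L2.inner_def]
  refine integral_congr_ae ?_
  filter_upwards [(memLp_tfShiftFun z (Lp.memLp g)).coeFn_toLp,
    (memLp_tfShiftFun w (Lp.memLp g)).coeFn_toLp] with t hz hw
  rw [tfShift, tfShift, hz, hw]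

theorem tfShift_zero (g : L2 d) : tfShift 0 g = g := by
  refine Lp.ext ?_
  filter_upwards [(memLp_tfShiftFun 0 (Lp.memLp g)).coeFn_toLp] with t ht
  rw [tfShift, ht]
  simp [tfShiftFun]

/-- Covariance of the inner products of time-frequency shifts, up to a phase. -/
theorem norm_inner_tfShift (g : L2 d) (z w : PhaseSpace d) :
    ‖(inner ℂ (tfShift z g) (tfShift w g) : ℂ)‖ = ‖stft g g (w - z)‖ := by
  have key : (inner ℂ (tfShift z g) (tfShift w g) : ℂ)
      = Complex.exp ((2 * Real.pi * inner ℝ (w - z).snd z.fst : ℝ) * Complex.I)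
        * inner ℂ (tfShift 0 g) (tfShift (w - z) g) := by
    -- Translating the variable by `z.fst` leaves only the relative shift `w - z` and a constant
    -- phase.
    rw [inner_tfShift, inner_tfShift, ← integral_add_right_eq_self _ z.fst, ← integral_const_mul]
    refine integral_congr_ae (Eventually.of_forall fun t => ?_)
    have e1 : t + z.fst - w.fst = t - (w - z).fst := by
      simp only [WithLp.sub_fst]; abel
    simp only [tfShiftFun, RCLike.inner_apply, add_sub_cancel_right, e1, map_mul,
      ← Complex.exp_conj]
    simp only [WithLp.zero_snd, WithLp.zero_fst, inner_zero_left, Complex.ofReal_zero, mul_zero,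
      Complex.exp_zero, map_zero, one_mul, sub_zero]
    have e2 : Complex.exp (2 * Real.pi * Complex.I * (inner ℝ w.snd (t + z.fst) : ℝ))
        * Complex.exp ((starRingEnd ℂ) (2 * Real.pi * Complex.I
          * (inner ℝ z.snd (t + z.fst) : ℝ)))
        = Complex.exp ((2 * Real.pi * inner ℝ (w - z).snd z.fst : ℝ) * Complex.I)
          * Complex.exp (2 * Real.pi * Complex.I * (inner ℝ (w - z).snd t : ℝ)) := by
      rw [← Complex.exp_add, ← Complex.exp_add]
      congr 1
      simp only [map_mul, Complex.conj_ofReal, Complex.conj_I, map_ofNat, WithLp.sub_snd,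
        inner_sub_left, inner_add_right]
      push_cast
      ring
    simp only [map_mul] at e2
    linear_combination (g (t - (w - z).fst) * (starRingEnd ℂ) (g t)) * e2
  rw [key, norm_mul, Complex.norm_exp_ofReal_mul_I, one_mul, tfShift_zero, stft, norm_inner_symm]

end Gabor

/-! ### Lattice points near a sphere -/

section LatticeCount

theorem pow_succ_sub_pow_succ_le {a b : ℝ} (hb : 0 ≤ b) (hab : b ≤ a) (m : ℕ) :
    a ^ (m + 1) - b ^ (m + 1) ≤ (m + 1) * a ^ m * (a - b) := by
  have ha : 0 ≤ a := hb.trans hab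
  induction m with
  | zero => simp
  | succ m ih =>
    have h1 : b ^ (m + 1) ≤ a ^ (m + 1) := pow_le_pow_left₀ hb hab _
    calc a ^ (m + 1 + 1) - b ^ (m + 1 + 1)
        = a * (a ^ (m + 1) - b ^ (m + 1)) + (a - b) * b ^ (m + 1) := by ring
      _ ≤ a * ((m + 1) * a ^ m * (a - b)) + (a - b) * a ^ (m + 1) :=
          add_le_add (mul_le_mul_of_nonneg_left ih ha)
            (mul_le_mul_of_nonneg_left h1 (sub_nonneg.2 hab))
      _ = _ := by push_cast; ring

variable {E : Type*} [NormedAddCommGroup E] [NormedSpace ℝ E] [FiniteDimensional ℝ E]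

/-- Packing bound for separated points in a spherical shell. -/
theorem card_mul_pow_add_pow_le_of_separated [Nontrivial E] {ι : Type*} (G : Finset ι) (p : ι → E)
    {r R ρ : ℝ} (hr : 0 < r) (hR : 0 ≤ R) (hρ : 0 ≤ ρ) (hρR : ρ ≤ R + r)
    (hsep : ∀ i ∈ G, ∀ j ∈ G, i ≠ j → 2 * r ≤ ‖p i - p j‖)
    (hout : ∀ i ∈ G, ‖p i‖ ≤ R) (hin : ∀ i ∈ G, ρ = 0 ∨ ρ + r ≤ ‖p i‖) :
    G.card * r ^ Module.finrank ℝ E + ρ ^ Module.finrank ℝ E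
      ≤ (R + r) ^ Module.finrank ℝ E := by
  borelize E
  let μ : Measure E := Measure.addHaar
  have hball : ∀ (x : E) {s : ℝ}, 0 ≤ s →
      μ.real (Metric.ball x s) = s ^ Module.finrank ℝ E * μ.real (Metric.ball 0 1) := by
    intro x s hs
    rw [Measure.real, Measure.addHaar_ball μ x hs, ENNReal.toReal_mul,
      ENNReal.toReal_ofReal (by positivity), Measure.real]
  have hpos : 0 < μ.real (Metric.ball (0 : E) 1) :=
    ENNReal.toReal_pos (Metric.measure_ball_pos μ 0 one_pos).ne' measure_ball_lt_top.ne
  have hdisj : Set.PairwiseDisjoint (↑G) fun i => Metric.ball (p i) r := by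
    intro i hi j hj hij
    refine Metric.ball_disjoint_ball ?_
    rw [dist_eq_norm]
    linarith [hsep i hi j hj hij]
  have hdisj' : Disjoint (⋃ i ∈ G, Metric.ball (p i) r) (Metric.ball 0 ρ) := by
    simp only [Set.disjoint_iUnion_left]
    intro i hi
    rcases hin i hi with h | h
    · simp [h]
    · refine Metric.ball_disjoint_ball ?_
      rw [dist_zero_right]
      linarith
  -- Disjoint balls inside a larger one: comparing volumes gives the bound.
  have hsub : (⋃ i ∈ G, Metric.ball (p i) r) ∪ Metric.ball 0 ρ ⊆ Metric.ball 0 (R + r) := by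
    refine Set.union_subset (Set.iUnion₂_subset fun i hi => Metric.ball_subset_ball' ?_)
      (Metric.ball_subset_ball hρR)
    rw [dist_zero_right]
    linarith [hout i hi]
  have hU : μ.real (⋃ i ∈ G, Metric.ball (p i) r)
      = G.card * (r ^ Module.finrank ℝ E * μ.real (Metric.ball 0 1)) := by
    rw [measureReal_biUnion_finset hdisj (fun i _ => measurableSet_ball)
      (fun i _ => measure_ball_lt_top.ne)]
    simp [hball _ hr.le]
  have hle := measureReal_mono (μ := μ) hsub measure_ball_lt_top.ne
  rw [measureReal_union hdisj' measurableSet_ball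
    (measure_ne_top_of_subset (Set.subset_union_left.trans hsub) measure_ball_lt_top.ne)
    measure_ball_lt_top.ne, hU,
    hball 0 hρ, hball 0 (s := R + r) (by positivity)] at hle
  refine le_of_mul_le_mul_right ?_ hpos
  linarith

/-- The number of points of a lattice in a ball of radius `R` which a translation by `m` moves out
of the ball is at most of order `‖m‖ R ^ (n - 1)`. -/
theorem exists_card_boundary_le {n : ℕ} (hn : Module.finrank ℝ E = n + 1) (L : Submodule ℤ E)
    [DiscreteTopology L] :
    ∃ C : ℝ, 0 ≤ C ∧ ∀ R : ℝ, 1 ≤ R → ∀ (m : L) (G : Finset L),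
      (∀ l ∈ G, ‖(l : E)‖ ≤ R ∧ R < ‖((l + m : L) : E)‖) → G.card ≤ C * ‖(m : E)‖ * R ^ n := by
  have : Nontrivial E := Module.nontrivial_of_finrank_pos (R := ℝ) (by omega)
  obtain ⟨ε, hε, hL⟩ : ∃ ε > 0, ∀ l : L, l ≠ 0 → ε ≤ ‖(l : E)‖ := by
    obtain ⟨ε, hε, h⟩ := Metric.isOpen_singleton_iff.1 (isOpen_discrete ({0} : Set L))
    refine ⟨ε, hε, fun l hl => ?_⟩
    by_contra! hlt
    exact hl (h l (by simpa [dist_eq_norm] using hlt))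
  set r := ε / 2 with hr_def
  have hr : 0 < r := by positivity
  -- The factor `2` bounds the thickened shell width `‖m‖ + 2r` by `2‖m‖`; `1 + r` comes from `R + r
  -- ≤ (1 + r) R`, valid as `R ≥ 1`.
  refine ⟨2 * (n + 1) * (1 + r) ^ n / r ^ (n + 1), by positivity, fun R hR m G hG => ?_⟩
  rcases eq_or_ne m 0 with rfl | hm
  · have : G = ∅ := Finset.eq_empty_of_forall_notMem fun l hl => by
      have := hG l hl
      simp only [add_zero] at this
      linarith
    simp [this]
  have hm' : 2 * r ≤ ‖(m : E)‖ := by linarith [hL m hm]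
  -- The points have norm above `R - ‖m‖`; the maximum with `0` covers translations so long that no
  -- inner ball remains.
  have hρR : max (R - ‖(m : E)‖ - r) 0 ≤ R + r := max_le (by linarith) (by linarith)
  have h1 := card_mul_pow_add_pow_le_of_separated G (fun l : L => (l : E)) (R := R)
    (ρ := max (R - ‖(m : E)‖ - r) 0) hr (by linarith) (le_max_right _ _) hρR
    (fun i _ j _ hij => by
      have := hL (i - j) (sub_ne_zero.2 hij)
      rw [Submodule.coe_sub] at this
      linarith) (fun i hi => (hG i hi).1) (fun i hi => by
      rcases le_total (R - ‖(m : E)‖ - r) 0 with h | h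
      · exact Or.inl (max_eq_right h)
      · right
        rw [max_eq_left h]
        have h2 := (hG i hi).2
        have h3 := norm_add_le (i : E) (m : E)
        rw [Submodule.coe_add] at h2
        linarith)
  have h2 := pow_succ_sub_pow_succ_le (le_max_right (R - ‖(m : E)‖ - r) 0) hρR n
  rw [hn] at h1
  have h3 : R + r - max (R - ‖(m : E)‖ - r) 0 ≤ 2 * ‖(m : E)‖ := by
    linarith [le_max_left (R - ‖(m : E)‖ - r) 0]
  have h4 : (R + r) ^ n ≤ ((1 + r) * R) ^ n :=
    pow_le_pow_left₀ (by linarith) (by nlinarith) n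
  have h5 : (G.card : ℝ) * r ^ (n + 1) ≤ (n + 1) * ((1 + r) * R) ^ n * (2 * ‖(m : E)‖) := by
    refine (le_sub_iff_add_le.2 h1).trans (h2.trans ?_)
    have : 0 ≤ R + r - max (R - ‖(m : E)‖ - r) 0 := sub_nonneg.2 hρR
    gcongr
  have e : 2 * (n + 1) * (1 + r) ^ n / r ^ (n + 1) * ‖(m : E)‖ * R ^ n
      = (n + 1) * ((1 + r) * R) ^ n * (2 * ‖(m : E)‖) / r ^ (n + 1) := by
    rw [mul_pow]; ring
  rw [e, le_div_iff₀ (by positivity)]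
  exact h5

end LatticeCount

/-! ### The Gabor process and its variance -/

section GaborProcess

/-- By the projection identity each summand is the tail of `‖K i j‖ ^ 2` over `j ∉ F`. Substituting
`j = i + m` and exchanging sums counts the `i` that `m` moves out of `F`. -/
theorem hasSum_card_boundary_mul {ι : Type*} [AddCommGroup ι] [DecidableEq ι] {K : ι → ι → ℂ}
    {V : ι → ℝ} (hKV : ∀ i j, ‖K i j‖ ^ 2 = V (j - i))
    (hK : ∀ i, HasSum (fun j => ‖K i j‖ ^ 2) (K i i).re) (F : Finset ι) :
    HasSum (fun m => ({i ∈ F | i + m ∉ F}.card : ℝ) * V m)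
      (∑ i ∈ F, ((K i i).re - ∑ j ∈ F, ‖K i j‖ ^ 2)) := by
  have h1 : ∀ i, HasSum (fun m => if i + m ∉ F then V m else 0)
      ((K i i).re - ∑ j ∈ F, ‖K i j‖ ^ 2) := by
    intro i
    have h2 : HasSum (fun j => if j ∈ F then ‖K i j‖ ^ 2 else 0) (∑ j ∈ F, ‖K i j‖ ^ 2) := by
      have h := hasSum_sum_of_ne_finset_zero (s := F) (L := .unconditional ι)
        (f := fun j => if j ∈ F then ‖K i j‖ ^ 2 else 0) (fun b hb => by simp [hb])
      rwa [Finset.sum_congr rfl fun j hj => if_pos hj] at h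
    have h3 := (Equiv.addLeft i).hasSum_iff.2 ((hK i).sub h2)
    refine h3.congr_fun fun m => ?_
    by_cases h : i + m ∈ F <;> simp [h, hKV]
  have h4 := hasSum_sum fun i (_ : i ∈ F) => h1 i
  refine h4.congr_fun fun m => ?_
  rw [← Finset.sum_filter, Finset.sum_const, nsmul_eq_mul]

variable {d : ℕ} {Λ : Submodule ℤ (PhaseSpace d)}

theorem finite_mem_closedBall [DiscreteTopology Λ] (R : ℝ) :
    {l : Λ | (l : PhaseSpace d) ∈ Metric.closedBall (0 : PhaseSpace d) R}.Finite := by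
  have h : IsClosed (X := PhaseSpace d) Λ :=
    @AddSubgroup.isClosed_of_discrete _ _ _ _ _ Λ.toAddSubgroup (inferInstanceAs (DiscreteTopology Λ))
  refine Set.Finite.of_finite_image (f := Subtype.val) ?_ Subtype.val_injective.injOn
  refine (Metric.finite_isBounded_inter_isClosed DiscreteTopology.isDiscrete
    (Metric.isBounded_closedBall (x := (0 : PhaseSpace d)) (r := R)) h).subset ?_
  rintro _ ⟨l, hl, rfl⟩
  exact ⟨hl, l.2⟩

theorem ballCount_eq_sum_indicator {S : Type*} (X : S → Set Λ) {R : ℝ} {F : Finset Λ}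
    (hF : ∀ l : Λ, l ∈ F ↔ (l : PhaseSpace d) ∈ Metric.closedBall (0 : PhaseSpace d) R) :
    ballCount X R = fun s => ∑ l ∈ F, {s | l ∈ X s}.indicator (fun _ => (1 : ℝ)) s := by
  classical
  ext s
  have e : X s ∩ {l : Λ | (l : PhaseSpace d) ∈ Metric.closedBall (0 : PhaseSpace d) R}
      = ({l ∈ F | l ∈ X s} : Finset Λ) := by
    ext l
    simp only [Finset.coe_filter, Set.mem_inter_iff, Set.mem_ofPred_eq, hF, and_comm]
  rw [ballCount, e, Set.ncard_coe_finset, Finset.card_filter]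
  simp [Set.indicator_apply]

variable {g : L2 d} {A : ℝ}

theorem gaborKernel_star (g : L2 d) (l l' : Λ) :
    (A : ℂ)⁻¹ * gaborKernel g Λ l' l = star ((A : ℂ)⁻¹ * gaborKernel g Λ l l') := by
  simp [gaborKernel]

theorem norm_gaborKernel (g : L2 d) (l l' : Λ) :
    ‖gaborKernel g Λ l l'‖ = ‖stft g g ((l' - l : Λ) : PhaseSpace d)‖ :=
  norm_inner_tfShift g _ _

theorem posSemidef_gaborKernel (hA : 0 < A) (g : L2 d) (F : Finset Λ) :
    (Matrix.of fun i j : F => (A : ℂ)⁻¹ * gaborKernel g Λ i j).PosSemidef := by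
  have hA' : (0 : ℂ) ≤ (A : ℂ)⁻¹ := by
    rw [← Complex.ofReal_inv]; exact_mod_cast (inv_pos.2 hA).le
  exact (Matrix.posSemidef_gram ℂ fun i : F => tfShift (i : PhaseSpace d) g).smul hA'

theorem IsGaborFrame.hasSum (h : IsGaborFrame g Λ A A) (f : L2 d) :
    HasSum (fun l : Λ => ‖stft g f l‖ ^ 2) (A * ‖f‖ ^ 2) := by
  obtain ⟨hs, h1, h2⟩ := h.2.2 f
  exact le_antisymm h1 h2 ▸ hs.hasSum

theorem IsGaborFrame.posSemidef_one_sub [DecidableEq Λ] (h : IsGaborFrame g Λ A A)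
    (F : Finset Λ) :
    (1 - Matrix.of fun i j : F => (A : ℂ)⁻¹ * gaborKernel g Λ i j).PosSemidef := by
  refine posSemidef_one_sub_smul_gram h.1 (v := fun i : F => tfShift (i : PhaseSpace d) g)
    fun f => ?_
  refine le_trans (le_of_eq ?_)
    (sum_le_hasSum F (fun _ _ => sq_nonneg _) (h.hasSum f))
  exact Finset.sum_coe_sort F fun l : Λ => ‖stft g f l‖ ^ 2

/-- The frame identity at `f = π(l)g`; this is where tightness yields a projection rather than a
mere contraction. -/
theorem IsGaborFrame.hasSum_gaborKernel (h : IsGaborFrame g Λ A A) (l : Λ) :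
    HasSum (fun l' => ‖(A : ℂ)⁻¹ * gaborKernel g Λ l l'‖ ^ 2)
      ((A : ℂ)⁻¹ * gaborKernel g Λ l l).re := by
  have hA := h.1
  have h1 := (h.hasSum (tfShift (l : PhaseSpace d) g)).mul_left (A⁻¹ ^ 2)
  have e : ((A : ℂ)⁻¹ * gaborKernel g Λ l l).re
      = A⁻¹ ^ 2 * (A * ‖tfShift (l : PhaseSpace d) g‖ ^ 2) := by
    rw [gaborKernel, inner_self_eq_norm_sq_to_K, ← Complex.ofReal_inv, Complex.re_ofReal_mul]
    have : ((‖tfShift (l : PhaseSpace d) g‖ : ℂ) ^ 2).re = ‖tfShift (l : PhaseSpace d) g‖ ^ 2 := by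
      rw [← Complex.ofReal_pow, Complex.ofReal_re]
    refine (congrArg (A⁻¹ * ·) this).trans ?_
    field_simp
  rw [e]
  refine h1.congr_fun fun l' => ?_
  rw [norm_mul, mul_pow, gaborKernel, norm_inner_symm, stft]
  simp [abs_of_pos hA]

theorem finrank_phaseSpace (hd : 1 ≤ d) :
    Module.finrank ℝ (PhaseSpace d) = (2 * d - 1) + 1 := by
  rw [(WithLp.linearEquiv 2 ℝ _).finrank_eq, Module.finrank_prod, finrank_euclideanSpace_fin]
  omega

theorem memLp_ballCount [DiscreteTopology Λ] {S : Type*} [MeasurableSpace S] {P : Measure S}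
    [IsFiniteMeasure P] {X : S → Set Λ} {K : Λ → Λ → ℂ} (hX : IsDeterminantal P X K) (R : ℝ) :
    MemLp (ballCount X R) 2 P := by
  rw [ballCount_eq_sum_indicator X (F := (finite_mem_closedBall R).toFinset) (by simp)]
  exact memLp_sum_indicator hX.measurableSet_mem _

/-- A boundary-order variance bound for the determinantal process of a tight Gabor frame. -/
theorem isBigO_variance_ballCount [DiscreteTopology Λ] (hd : 1 ≤ d) (h : IsGaborFrame g Λ A A)
    (hg : MemMStar g Λ) {S : Type*} [MeasurableSpace S] {P : Measure S} [IsProbabilityMeasure P]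
    {X : S → Set Λ}
    (hX : IsDeterminantal P X fun l l' => (A : ℂ)⁻¹ * gaborKernel g Λ l l') :
    (fun R : ℝ => ProbabilityTheory.variance (ballCount X R) P) =O[atTop]
      fun R : ℝ => R ^ (2 * d - 1) := by
  classical
  obtain ⟨C, hC, hcount⟩ := exists_card_boundary_le (finrank_phaseSpace hd) Λ
  have hg' : HasSum (fun l : Λ => ‖(l : PhaseSpace d)‖ * ‖stft g g l‖ ^ 2) _ := hg.hasSum
  refine Asymptotics.IsBigO.of_bound
    (C * A⁻¹ ^ 2 * ∑' l : Λ, ‖(l : PhaseSpace d)‖ * ‖stft g g l‖ ^ 2) ?_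
  filter_upwards [eventually_ge_atTop (1 : ℝ)] with R hR
  set F := (finite_mem_closedBall (Λ := Λ) R).toFinset with hF_def
  have hF : ∀ l : Λ, l ∈ F ↔ ‖(l : PhaseSpace d)‖ ≤ R := fun l => by simp [hF_def]
  have hsum := hasSum_card_boundary_mul
    (V := fun m : Λ => A⁻¹ ^ 2 * ‖stft g g (m : PhaseSpace d)‖ ^ 2)
    (fun i j => by
      rw [norm_mul, mul_pow, norm_gaborKernel]
      simp [abs_of_pos h.1]) h.hasSum_gaborKernel F
  rw [Real.norm_of_nonneg (ProbabilityTheory.variance_nonneg _ _),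
    Real.norm_of_nonneg (by positivity), ballCount_eq_sum_indicator X (F := F) (by simp [hF]),
    hX.variance_sum_indicator (fun i j => gaborKernel_star g i j)]
  have hbound := hg'.mul_left (C * A⁻¹ ^ 2 * R ^ (2 * d - 1))
  -- Termwise comparison: the factor `‖m‖` from the boundary count is exactly the weight in
  -- `MemMStar`.
  refine (hasSum_le (fun m => ?_) hsum hbound).trans (le_of_eq (by ring))
  have h1 := hcount R hR m {i ∈ F | i + m ∉ F} fun l hl => by
    rw [Finset.mem_filter, hF, hF, not_le] at hl
    exact hl
  calc _ ≤ C * ‖(m : PhaseSpace d)‖ * R ^ (2 * d - 1)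
        * (A⁻¹ ^ 2 * ‖stft g g (m : PhaseSpace d)‖ ^ 2) :=
        mul_le_mul_of_nonneg_right h1 (by positivity)
    _ = _ := by ring

end GaborProcess

theorem theorem1p4 {d : ℕ} (hd : 1 ≤ d) (Λ : Submodule ℤ (PhaseSpace d)) [DiscreteTopology Λ]
    [IsZLattice ℝ Λ] (g : L2 d) (A : ℝ) (hframe : IsGaborFrame g Λ A A) (hg : MemMStar g Λ) :
    (∃! P : ProbabilityMeasure (Set Λ),
      IsDeterminantal (P : Measure (Set Λ)) id
        (fun l l' => (A : ℂ)⁻¹ * gaborKernel g Λ l l')) ∧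
    ∀ {S : Type*} [MeasurableSpace S] (P : Measure S) [IsProbabilityMeasure P] (X : S → Set Λ),
      IsDeterminantal P X (fun l l' => (A : ℂ)⁻¹ * gaborKernel g Λ l l') →
      IsHyperuniform P X ∧ IsClassIHyperuniform P X := by
  classical
  refine ⟨?_, fun P _ X hX => ?_⟩
  · have : Countable Λ := inferInstance
    obtain ⟨P, hP⟩ := exists_isDeterminantal
      (K := fun l l' : Λ => (A : ℂ)⁻¹ * gaborKernel g Λ l l')
      (fun F => posSemidef_gaborKernel hframe.1 g F) fun F => hframe.posSemidef_one_sub F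
    exact ⟨P, hP, fun Q hQ => Subtype.ext (IsDeterminantal.measure_unique
      (P := (Q : Measure (Set Λ))) (Q := (P : Measure (Set Λ))) hQ hP)⟩
  · have hO := isBigO_variance_ballCount hd hframe hg hX
    exact ⟨⟨memLp_ballCount hX, hO.trans_isLittleO (Asymptotics.isLittleO_pow_pow_atTop_of_lt
      (by omega))⟩, memLp_ballCount hX, hO⟩
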